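/- For integers $d\ge 1$ and $k\ge 0$ let $\mathcal C_d^k$ be the set of Boolean functions on $\{0,1\}^d$ that are conjunctions of at most $k$ literals (a literal is a variable $x_i$ or its negation; the empty conjunction is the constant true function). A $k$-decision list over $d$ variables is a function $\{0,1\}^d\to\{0,1\}$ of the form "if $f_1$ then $b_1$, else if $f_2$ then $b_2$, ..., else if $f_r$ then $b_r$, else $b_{r+1}$" with $r\ge 0$, $f_i\in\mathcal C_d^k$ and $b_i\in\{0,1\}$. A learner on $n$ examples is a randomized map $A$ that sends a dataset $S\in(\{0,1\}^d\times\{0,1\})^n$ to a hypothesis $h:\{0,1\}^d\to\{0,1\}$. It is $(\varepsilon,\delta)$-differentially private (DP) if $\Pr[A(S)\in R]\le e^{\varepsilon}\Pr[A(S')\in R]+\delta$ for all datasets $S,S'$ that differ in a single example and all sets $R$ of hypotheses. It is an $(\alpha,\beta)$-PAC learner for a class $\mathcal C$ if for every distribution $\mathcal D$ on $\{0,1\}^d$ and every $c\in\mathcal C$, with probability at least $1-\beta$ over $x_1,\dots,x_n$ drawn i.i.d. from $\mathcal D$ and the randomness of $A$, the hypothesis $h=A((x_i,c(x_i))_{i=1}^n)$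 satisfies $\Pr_{x\sim\mathcal D}[c(x)\ne h(x)]\le\alpha$. Then: 1. $|\mathcal C_d^k|\le e^2 d^k$ for all $d\ge 1$ and $k\ge 0$. 2. There is an $(\varepsilon,\delta)$-DP $(\alpha,\beta)$-PAC learner for $k$-decision lists over $d$ variables with sample complexity $$O\!\left(\frac{d^k\,\log(d^k/\beta)\,\log(1/\delta)}{\alpha\,\varepsilon}\right).$$ Precisely: for all $\varepsilon_0>0$ and $\delta_0,\beta_0\in(0,1)$ there is a constant $K>0$, depending only on these three bounds, such that for all $d\ge1$, $k\ge0$, $0<\varepsilon\le\varepsilon_0$, $0<\delta\le\delta_0$, $0<\alpha\le1$ and $0<\beta\le\beta_0$ there is an integer $m\ge 0$ with $m\le K\,d^k\log(d^k/\beta)\log(1/\delta)/(\alpha\varepsilon)$ such that for every $n\ge m$ there is a learner on $n$ examples that is $(\varepsilon,\delta)$-DP and an $(\alpha,\beta)$-PAC learner for the class of $k$-decision lists over $d$ variables. -/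

import Mathlib

open MeasureTheory
open scoped ENNReal

namespace DPLearn

/-- The conjunction of a finite set of literals over `d` Boolean variables: the literal `(i, b)`
holds at `x` when `x i = b`, so `(i, true)` is the variable and `(i, false)` its negation. The empty
conjunction is the constant true function. -/
def conjunction {d : ℕ} (l : Finset (Fin d × Bool)) : (Fin d → Bool) → Bool :=
  fun x => decide (∀ p ∈ l, x p.1 = p.2)

/-- The set of Boolean functions on `d` variables computed by conjunctions of at most `k` literals. -/
def conjunctions (d k : ℕ) : Set ((Fin d → Bool) → Bool) :=
  {f | ∃ l : Finset (Fin d × Bool), l.card ≤ k ∧ f = conjunction l}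

/-- The function "if `f₁` then `b₁`, else if `f₂` then `b₂`, ..., else `b`". -/
def evalList {X : Type*} : List ((X → Bool) × Bool) → Bool → X → Bool
  | [], b, _ => b
  | (f, c) :: r, b, x => if f x = true then c else evalList r b x

/-- The concept class of decision lists (of arbitrary length) with features in `F`. -/
def decisionLists {X : Type*} (F : Set (X → Bool)) : Set (X → Bool) :=
  {c | ∃ (r : List ((X → Bool) × Bool)) (b : Bool), (∀ p ∈ r, p.1 ∈ F) ∧ c = evalList r b}

/-- The concept class of `k`-decision lists over `d` Boolean variables. -/
def kDecisionLists (d k : ℕ) : Set ((Fin d → Bool) → Bool) :=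
  decisionLists (conjunctions d k)

/-- A randomized learning algorithm taking `n` labeled examples to a random hypothesis. -/
abbrev Learner (X : Type*) (n : ℕ) := (Fin n → X × Bool) → PMF (X → Bool)

/-- Two datasets are neighboring if they differ in (at most) a single example. -/
def Neighboring {Z : Type*} {n : ℕ} (S S' : Fin n → Z) : Prop :=
  ∃ i, ∀ j, j ≠ i → S j = S' j

/-- `(ε, δ)`-differential privacy; `(A S).toOuterMeasure R` is `Pr[A(S) ∈ R]`. -/
def IsDP {X : Type*} {n : ℕ} (A : Learner X n) (ε δ : ℝ) : Prop :=
  ∀ S S' : Fin n → X × Bool, Neighboring S S' → ∀ R : Set (X → Bool),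
    (A S).toOuterMeasure R ≤
      ENNReal.ofReal (Real.exp ε) * (A S').toOuterMeasure R + ENNReal.ofReal δ

/-- `err_D(c, h)`, the probability that `c` and `h` disagree on a point drawn from `D`. -/
noncomputable def err {X : Type*} [MeasurableSpace X] (D : Measure X) (c h : X → Bool) : ℝ≥0∞ :=
  D {x | c x ≠ h x}

/-- `A` is an `(α, β)`-PAC learner for the class `C` of functions on a finite domain: for every
distribution `D` on the domain and every target `c ∈ C`, the probability that `A` returns `h` with
`err_D(c, h) ≤ α` is at least `1 - β`. The probability is over `n` i.i.d. points drawn from `D`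
and labeled by `c` (the outer integral) and over the internal randomness of `A`. -/
def IsPAC {X : Type*} [Finite X] [MeasurableSpace X] [MeasurableSingletonClass X] {n : ℕ}
    (A : Learner X n) (C : Set (X → Bool)) (α β : ℝ) : Prop :=
  ∀ (D : Measure X) [IsProbabilityMeasure D], ∀ c ∈ C,
    ENNReal.ofReal (1 - β) ≤
      ∫⁻ x : Fin n → X, (A fun i => (x i, c (x i))).toOuterMeasure
        {h | err D c h ≤ ENNReal.ofReal α} ∂(Measure.pi fun _ => D)

end DPLearn

/-! The count: a conjunction containing no complementary pair of literals is a set of variables with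
signs, and all contradictory conjunctions are one function. Comparing with the exponential series at
2 gives `e^2 * d^k`.

The learner: let `N` be the number of rules (conjunction, label). For `N` rounds the exponential
mechanism picks an unused rule, with weight `(1 + c)⁻¹` to the power of its mistakes on the examples
still active; the examples it covers are then dropped.

Privacy does not degrade with the number of rounds. Suppose an example `i` is active, and let `p` be
the probability that the next rule mislabels it. The presence of `i` raises the probability of any
rule by a factor of at most `1 + c * p`, while `i` stays active with probability at most `1 - p ≤
exp (-p)`. A large accumulated loss is therefore unlikely: losing more than about `c * b` has
probability at most `exp (-b)` (`greedyProb_insert_le`). In the other direction loss occurs only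
when a rule mislabels `i`, which removes `i`, so the factor `1 + c` is paid at most once
(`greedyProb_le_insert`).

Accuracy: some unused rule always makes no mistake on the active examples, so each selected rule
makes at most `s` mistakes except with probability `N * ρ^s` (`greedyProb_failureSet_le`). The
output then has at most `N * s` empirical errors and belongs to a class of at most `N^N` lists, so a
Chernoff and union bound give generalization (`isPAC_greedyList`). Since `N = O(d^k)`, the choices
of `c`, `s` and `n` give the stated rate. -/

namespace DPLearn

/-! ### Counting conjunctions -/

section Counting

/-- The conjunction over the variables in `T`, positive on `U` and negated elsewhere. -/
def signedConjunction {d : ℕ} (T U : Finset (Fin d)) : (Fin d → Bool) → Bool :=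
  conjunction (T.image fun i => (i, decide (i ∈ U)))

/-- All pairs `U ⊆ T` of sets of variables with `T` of size at most `k`. -/
def signedSupports (d k : ℕ) : Finset (Σ _ : Finset (Fin d), Finset (Fin d)) :=
  (Finset.range (k + 1)).biUnion fun j =>
    (Finset.powersetCard j Finset.univ).sigma fun T => T.powerset

theorem card_signedSupports_le (d k : ℕ) :
    (signedSupports d k).card ≤ ∑ j ∈ Finset.range (k + 1), d.choose j * 2 ^ j := by
  unfold signedSupports
  refine Finset.card_biUnion_le.trans (Finset.sum_le_sum fun j _ => le_of_eq ?_)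
  rw [Finset.card_sigma, Finset.sum_congr rfl (g := fun _ => 2 ^ j)]
  · simp
  · intro T hT
    rw [Finset.card_powerset, (Finset.mem_powersetCard.mp hT).2]

theorem conjunction_eq_false {d : ℕ} {l : Finset (Fin d × Bool)} {i : Fin d}
    (ht : (i, true) ∈ l) (hf : (i, false) ∈ l) : conjunction l = fun _ => false := by
  funext x
  simp only [conjunction, decide_eq_false_iff_not]
  intro h
  have h1 := h _ ht
  have h2 := h _ hf
  simp_all

theorem conjunction_eq_signedConjunction {d : ℕ} {l : Finset (Fin d × Bool)}
    (h : ∀ i, (i, true) ∈ l → (i, false) ∉ l) :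
    conjunction l = signedConjunction (l.image Prod.fst)
      ((l.image Prod.fst).filter fun i => (i, true) ∈ l) := by
  unfold signedConjunction
  congr 1
  ext ⟨i, b⟩
  simp only [Finset.mem_image, Finset.mem_filter, Prod.mk.injEq, Prod.exists, exists_and_right,
    exists_eq_right]
  constructor
  · intro hb
    refine ⟨i, ⟨b, hb⟩, rfl, ?_⟩
    cases b
    · have ht : (i, true) ∉ l := fun h' => h i h' hb
      simp [ht]
    · simp [hb]
  · rintro ⟨j, ⟨b', hb'⟩, rfl, rfl⟩
    by_cases ht : (j, true) ∈ l
    · have : ∃ x, (j, x) ∈ l := ⟨_, ht⟩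
      simp [ht, this]
    · cases b'
      · simpa [ht] using hb'
      · exact absurd hb' ht

theorem conjunctions_subset (d k : ℕ) :
    conjunctions d k ⊆ ((signedSupports d k).image fun p => signedConjunction p.1 p.2 : Finset _) ∪
      (if 2 ≤ k then {fun _ => false} else ∅) := by
  rintro f ⟨l, hl, rfl⟩
  by_cases h : ∀ i, (i, true) ∈ l → (i, false) ∉ l
  · left
    rw [conjunction_eq_signedConjunction h]
    refine Finset.mem_coe.mpr (Finset.mem_image.mpr ⟨⟨_, _⟩, ?_, rfl⟩)
    simp only [signedSupports, Finset.mem_sigma, Finset.mem_biUnion, Finset.mem_range,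
      Finset.mem_powersetCard, Finset.mem_powerset]
    exact ⟨_, Nat.lt_succ_of_le (Finset.card_image_le.trans hl), ⟨Finset.subset_univ _, rfl⟩,
      Finset.filter_subset _ _⟩
  · push Not at h
    obtain ⟨i, ht, hf⟩ := h
    have h2 : 2 ≤ k := by
      refine le_trans ?_ hl
      rw [← Finset.card_pair (a := (i, true)) (b := (i, false)) (by simp)]
      exact Finset.card_le_card (by simp [Finset.insert_subset_iff, ht, hf])
    right
    simp [h2, conjunction_eq_false ht hf]

theorem ncard_conjunctions_le (d k : ℕ) :
    (conjunctions d k).ncard ≤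
      (∑ j ∈ Finset.range (k + 1), d.choose j * 2 ^ j) + if 2 ≤ k then 1 else 0 := by
  refine (Set.ncard_le_ncard (conjunctions_subset d k) (Set.toFinite _)).trans ?_
  refine (Set.ncard_union_le _ _).trans (add_le_add ?_ ?_)
  · rw [Set.ncard_coe_finset]
    exact Finset.card_image_le.trans (card_signedSupports_le d k)
  · split_ifs <;> simp

theorem choose_mul_two_pow_le (d j : ℕ) :
    ((d.choose j * 2 ^ j : ℕ) : ℝ) ≤ (d : ℝ) ^ j * (2 ^ j / j.factorial) := by
  push_cast
  calc (d.choose j : ℝ) * 2 ^ j ≤ ((d : ℝ) ^ j / j.factorial) * 2 ^ j :=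
        mul_le_mul_of_nonneg_right (Nat.choose_le_pow_div j d) (by positivity)
    _ = _ := by ring

/-- Passing from `k` to `k + 1` costs only a factor `d ≥ 1` on the old terms. The extra 1 for the
constant false function enters at `k = 2`, where `2 * d^2 + 2 ≤ 5 * d^2` has room for it. -/
theorem sum_choose_mul_two_pow_le {d : ℕ} (hd : 1 ≤ d) (k : ℕ) :
    (((∑ j ∈ Finset.range (k + 1), d.choose j * 2 ^ j) + if 2 ≤ k then 1 else 0 : ℕ) : ℝ) ≤
      (d : ℝ) ^ k * ∑ j ∈ Finset.range (k + 1), (2 : ℝ) ^ j / j.factorial := by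
  have hd' : (1 : ℝ) ≤ d := by exact_mod_cast hd
  have step : ∀ k : ℕ, ∀ a : ℝ, a ≤ (d : ℝ) ^ k * ∑ j ∈ Finset.range (k + 1),
      (2 : ℝ) ^ j / j.factorial → a + ((d.choose (k + 1) * 2 ^ (k + 1) : ℕ) : ℝ) ≤
        (d : ℝ) ^ (k + 1) * ∑ j ∈ Finset.range (k + 1 + 1), (2 : ℝ) ^ j / j.factorial := by
    intro k a ha
    rw [Finset.sum_range_succ _ (k + 1), mul_add]
    refine add_le_add (ha.trans ?_) (choose_mul_two_pow_le d (k + 1))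
    exact mul_le_mul_of_nonneg_right (pow_le_pow_right₀ hd' (Nat.le_succ k))
      (Finset.sum_nonneg fun j _ => by positivity)
  rcases k with _ | _ | k
  · simp
  · simp [Finset.sum_range_succ]; nlinarith
  · induction k with
    | zero =>
      have h2 : ((d.choose 2 : ℕ) : ℝ) = d * (d - 1) / 2 := Nat.cast_choose_two ℝ d
      simp [Finset.sum_range_succ, h2, Nat.factorial]
      nlinarith
    | succ k ih =>
      have := step (k + 2) _ ih
      refine le_trans (le_of_eq ?_) this
      rw [Finset.sum_range_succ _ (k + 1 + 1 + 1)]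
      simp only [le_add_iff_nonneg_left, zero_le, if_true]
      push_cast
      ring

theorem ncard_conjunctions_le_exp {d : ℕ} (hd : 1 ≤ d) (k : ℕ) :
    ((conjunctions d k).ncard : ℝ) ≤ Real.exp 2 * (d : ℝ) ^ k := by
  calc ((conjunctions d k).ncard : ℝ)
      ≤ (((∑ j ∈ Finset.range (k + 1), d.choose j * 2 ^ j) + if 2 ≤ k then 1 else 0 : ℕ) : ℝ) := by
        exact_mod_cast ncard_conjunctions_le d k
    _ ≤ _ := sum_choose_mul_two_pow_le hd k
    _ ≤ (d : ℝ) ^ k * Real.exp 2 :=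
        mul_le_mul_of_nonneg_left (Real.sum_le_exp_of_nonneg (by norm_num) _) (by positivity)
    _ = _ := mul_comm _ _

end Counting

/-! ### The greedy exponential mechanism -/

section Mechanism

variable {X : Type*} {n : ℕ}

/-- The number of active examples that the rule `r` covers with the wrong label. -/
def mistakes (S : Fin n → X × Bool) (act : Finset (Fin n)) (r : (X → Bool) × Bool) : ℕ :=
  (act.filter fun i => r.1 (S i).1 = true ∧ r.2 ≠ (S i).2).card

/-- The active examples that the rule `r` does not cover. -/
def survivors (S : Fin n → X × Bool) (act : Finset (Fin n)) (r : (X → Bool) × Bool) :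
    Finset (Fin n) :=
  act.filter fun i => r.1 (S i).1 = false

/-- The hypothesis that applies the rule `r` where it fires and `h` elsewhere. -/
def prependRule (r : (X → Bool) × Bool) (h : X → Bool) : X → Bool :=
  fun x => if r.1 x = true then r.2 else h x

/-- The normalizing constant of the exponential mechanism. -/
noncomputable def partitionSum (ρ : ℝ) (S : Fin n → X × Bool) (avail : Finset ((X → Bool) × Bool))
    (act : Finset (Fin n)) : ℝ :=
  ∑ r ∈ avail, ρ ^ mistakes S act r

/-- The probability with which the exponential mechanism selects the rule `r`. -/
noncomputable def ruleProb (ρ : ℝ) (S : Fin n → X × Bool) (avail : Finset ((X → Bool) × Bool))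
    (act : Finset (Fin n)) (r : (X → Bool) × Bool) : ℝ :=
  ρ ^ mistakes S act r / partitionSum ρ S avail act

theorem partitionSum_pos {ρ : ℝ} (hρ : 0 < ρ) (S : Fin n → X × Bool)
    {avail : Finset ((X → Bool) × Bool)} (hav : avail.Nonempty) (act : Finset (Fin n)) :
    0 < partitionSum ρ S avail act :=
  Finset.sum_pos (fun _ _ => pow_pos hρ _) hav

theorem ruleProb_nonneg {ρ : ℝ} (hρ : 0 < ρ) (S : Fin n → X × Bool)
    (avail : Finset ((X → Bool) × Bool)) (act : Finset (Fin n)) (r : (X → Bool) × Bool) :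
    0 ≤ ruleProb ρ S avail act r :=
  div_nonneg (pow_pos hρ _).le (Finset.sum_nonneg fun _ _ => (pow_pos hρ _).le)

theorem sum_ruleProb {ρ : ℝ} (hρ : 0 < ρ) (S : Fin n → X × Bool)
    {avail : Finset ((X → Bool) × Bool)} (hav : avail.Nonempty) (act : Finset (Fin n)) :
    ∑ r ∈ avail, ruleProb ρ S avail act r = 1 := by
  unfold ruleProb
  rw [← Finset.sum_div]
  exact div_self (partitionSum_pos hρ S hav act).ne'

open scoped Classical in
/-- The exponential mechanism on the available rules, scored by minus the number of mistakes. -/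
noncomputable def selectRule {ρ : ℝ} (hρ : 0 < ρ) (S : Fin n → X × Bool)
    (avail : Finset ((X → Bool) × Bool)) (hav : avail.Nonempty) (act : Finset (Fin n)) :
    PMF ((X → Bool) × Bool) :=
  PMF.ofFinset (fun r => if r ∈ avail then ENNReal.ofReal (ruleProb ρ S avail act r) else 0) avail
    (by
      rw [Finset.sum_congr rfl fun r hr => if_pos hr,
        ← ENNReal.ofReal_sum_of_nonneg fun r _ => ruleProb_nonneg hρ S avail act r,
        sum_ruleProb hρ S hav act, ENNReal.ofReal_one])
    (fun r hr => if_neg hr)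

open scoped Classical in
/-- The private greedy learner: `k` times, select an available rule by the exponential mechanism,
append it to the decision list, and discard it and the examples that it covers. -/
noncomputable def greedyList {ρ : ℝ} (hρ : 0 < ρ) (S : Fin n → X × Bool) :
    ℕ → Finset ((X → Bool) × Bool) → Finset (Fin n) → PMF (X → Bool)
  | 0, _, _ => PMF.pure fun _ => false
  | k + 1, avail, act =>
    if hav : avail.Nonempty then
      (selectRule hρ S avail hav act).bind fun r =>
        (greedyList hρ S k (avail.erase r) (survivors S act r)).map (prependRule r)
    else PMF.pure fun _ => false

open scoped Classical in
/-- The probability that the hypothesis returned by `greedyList` lies in `R`. -/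
noncomputable def greedyProb (ρ : ℝ) (S : Fin n → X × Bool) :
    ℕ → Finset ((X → Bool) × Bool) → Finset (Fin n) → Set (X → Bool) → ℝ
  | 0, _, _, R => if (fun _ => false) ∈ R then 1 else 0
  | k + 1, avail, act, R =>
    if avail.Nonempty then
      ∑ r ∈ avail, ruleProb ρ S avail act r *
        greedyProb ρ S k (avail.erase r) (survivors S act r) (prependRule r ⁻¹' R)
    else if (fun _ => false) ∈ R then 1 else 0

theorem greedyProb_nonneg {ρ : ℝ} (hρ : 0 < ρ) (S : Fin n → X × Bool) (k : ℕ)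
    (avail : Finset ((X → Bool) × Bool)) (act : Finset (Fin n)) (R : Set (X → Bool)) :
    0 ≤ greedyProb ρ S k avail act R := by
  induction k generalizing avail act R with
  | zero => unfold greedyProb; split_ifs <;> norm_num
  | succ k ih =>
    unfold greedyProb
    split_ifs
    · exact Finset.sum_nonneg fun r _ => mul_nonneg (ruleProb_nonneg hρ S avail act r) (ih _ _ _)
    all_goals norm_num

theorem greedyProb_le_one {ρ : ℝ} (hρ : 0 < ρ) (S : Fin n → X × Bool) (k : ℕ)
    (avail : Finset ((X → Bool) × Bool)) (act : Finset (Fin n)) (R : Set (X → Bool)) :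
    greedyProb ρ S k avail act R ≤ 1 := by
  induction k generalizing avail act R with
  | zero => unfold greedyProb; split_ifs <;> norm_num
  | succ k ih =>
    unfold greedyProb
    split_ifs with hav
    · rw [← sum_ruleProb hρ S hav act]
      exact Finset.sum_le_sum fun r _ =>
        mul_le_of_le_one_right (ruleProb_nonneg hρ S avail act r) (ih _ _ _)
    all_goals norm_num

/-- Transfers every later estimate to a real-valued recursion, where induction on the rounds is
plain arithmetic. -/
theorem toOuterMeasure_greedyList {ρ : ℝ} (hρ : 0 < ρ) (S : Fin n → X × Bool) (k : ℕ)
    (avail : Finset ((X → Bool) × Bool)) (act : Finset (Fin n)) (R : Set (X → Bool)) :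
    (greedyList hρ S k avail act).toOuterMeasure R =
      ENNReal.ofReal (greedyProb ρ S k avail act R) := by
  classical
  induction k generalizing avail act R with
  | zero =>
    unfold greedyList greedyProb
    rw [PMF.toOuterMeasure_pure_apply]
    split_ifs <;> simp
  | succ k ih =>
    unfold greedyList greedyProb
    split_ifs with hav hR
    · rw [PMF.toOuterMeasure_bind_apply, ENNReal.ofReal_sum_of_nonneg fun r _ => mul_nonneg
        (ruleProb_nonneg hρ S avail act r) (greedyProb_nonneg hρ S _ _ _ _)]
      rw [tsum_eq_sum (s := avail)]
      · refine Finset.sum_congr rfl fun r hr => ?_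
        rw [PMF.toOuterMeasure_map_apply, ih, ENNReal.ofReal_mul (ruleProb_nonneg hρ S avail act r)]
        simp [selectRule, hr]
      · intro r hr
        simp [selectRule, hr]
    · rw [PMF.toOuterMeasure_pure_apply, if_pos hR, ENNReal.ofReal_one]
    · rw [PMF.toOuterMeasure_pure_apply, if_neg hR, ENNReal.ofReal_zero]

end Mechanism

/-! ### Differential privacy -/

section Privacy

variable {X : Type*} {n : ℕ}

theorem mistakes_insert (S : Fin n → X × Bool) {act : Finset (Fin n)} {i : Fin n} (hi : i ∉ act)
    (r : (X → Bool) × Bool) :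
    mistakes S (insert i act) r =
      mistakes S act r + if r.1 (S i).1 = true ∧ r.2 ≠ (S i).2 then 1 else 0 := by
  unfold mistakes
  rw [Finset.filter_insert]
  split_ifs with h
  · rw [Finset.card_insert_of_notMem (by simp [hi])]
  · rfl

theorem survivors_insert_of_covers (S : Fin n → X × Bool) {act : Finset (Fin n)} {i : Fin n}
    {r : (X → Bool) × Bool} (h : r.1 (S i).1 = true) :
    survivors S (insert i act) r = survivors S act r := by
  simp [survivors, Finset.filter_insert, h]

theorem survivors_insert_of_not_covers (S : Fin n → X × Bool) {act : Finset (Fin n)} {i : Fin n}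
    {r : (X → Bool) × Bool} (h : r.1 (S i).1 = false) :
    survivors S (insert i act) r = insert i (survivors S act r) := by
  simp [survivors, Finset.filter_insert, h]

theorem notMem_survivors (S : Fin n → X × Bool) {act : Finset (Fin n)} {i : Fin n} (hi : i ∉ act)
    (r : (X → Bool) × Bool) : i ∉ survivors S act r := by
  simp [survivors, hi]

variable {c : ℝ}

theorem pow_mistakes_insert (hc : 0 ≤ c) (S : Fin n → X × Bool) {act : Finset (Fin n)} {i : Fin n}
    (hi : i ∉ act) (r : (X → Bool) × Bool) :
    (1 + c)⁻¹ ^ mistakes S act r = (1 + c)⁻¹ ^ mistakes S (insert i act) r +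
      if r.1 (S i).1 = true ∧ r.2 ≠ (S i).2 then
        c * (1 + c)⁻¹ ^ mistakes S (insert i act) r else 0 := by
  have : 1 + c ≠ 0 := by positivity
  rw [mistakes_insert S hi]
  split_ifs
  · rw [pow_succ]
    field_simp
  · simp

theorem pow_mistakes_insert_le (hc : 0 ≤ c) (S : Fin n → X × Bool) {act : Finset (Fin n)}
    {i : Fin n} (hi : i ∉ act) (r : (X → Bool) × Bool) :
    (1 + c)⁻¹ ^ mistakes S (insert i act) r ≤ (1 + c)⁻¹ ^ mistakes S act r := by
  rw [pow_mistakes_insert hc S hi r]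
  split_ifs
  · exact le_add_of_nonneg_right (by positivity)
  · simp

theorem partitionSum_insert_le (hc : 0 ≤ c) (S : Fin n → X × Bool) {act : Finset (Fin n)}
    {i : Fin n} (hi : i ∉ act) (avail : Finset ((X → Bool) × Bool)) :
    partitionSum (1 + c)⁻¹ S avail (insert i act) ≤ partitionSum (1 + c)⁻¹ S avail act :=
  Finset.sum_le_sum fun r _ => pow_mistakes_insert_le hc S hi r

/-- The probability of selecting a rule that mislabels the example `i`. -/
noncomputable def mistakeProb (ρ : ℝ) (S : Fin n → X × Bool) (avail : Finset ((X → Bool) × Bool))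
    (act : Finset (Fin n)) (i : Fin n) : ℝ :=
  ∑ r ∈ avail with r.1 (S i).1 = true ∧ r.2 ≠ (S i).2, ruleProb ρ S avail act r

theorem mistakeProb_nonneg {ρ : ℝ} (hρ : 0 < ρ) (S : Fin n → X × Bool)
    (avail : Finset ((X → Bool) × Bool)) (act : Finset (Fin n)) (i : Fin n) :
    0 ≤ mistakeProb ρ S avail act i :=
  Finset.sum_nonneg fun r _ => ruleProb_nonneg hρ S avail act r

theorem mistakeProb_add_le_one {ρ : ℝ} (hρ : 0 < ρ) (S : Fin n → X × Bool)
    {avail : Finset ((X → Bool) × Bool)} (hav : avail.Nonempty) (act : Finset (Fin n))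
    (i : Fin n) :
    mistakeProb ρ S avail act i +
      ∑ r ∈ avail with r.1 (S i).1 = false, ruleProb ρ S avail act r ≤ 1 := by
  classical
  rw [← sum_ruleProb hρ S hav act, mistakeProb, ← Finset.sum_union]
  · exact Finset.sum_le_sum_of_subset_of_nonneg
      (Finset.union_subset (Finset.filter_subset _ _) (Finset.filter_subset _ _))
      fun r _ _ => ruleProb_nonneg hρ S avail act r
  · rw [Finset.disjoint_filter]
    rintro r _ ⟨h, _⟩
    simp [h]

/-- Removing `i` multiplies the weight of exactly the rules that mislabel it by `1 + c`. With base
`(1 + c)⁻¹` the relation is an identity, linear in the mistake probability. -/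
theorem partitionSum_eq_insert (hc : 0 ≤ c) (S : Fin n → X × Bool) {act : Finset (Fin n)}
    {i : Fin n} (hi : i ∉ act) {avail : Finset ((X → Bool) × Bool)} (hav : avail.Nonempty) :
    partitionSum (1 + c)⁻¹ S avail act = partitionSum (1 + c)⁻¹ S avail (insert i act) *
      (1 + c * mistakeProb (1 + c)⁻¹ S avail (insert i act) i) := by
  have hρ : 0 < (1 + c)⁻¹ := by positivity
  have hZ := (partitionSum_pos hρ S hav (insert i act)).ne'
  have : partitionSum (1 + c)⁻¹ S avail (insert i act) *
      mistakeProb (1 + c)⁻¹ S avail (insert i act) i =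
      ∑ r ∈ avail with r.1 (S i).1 = true ∧ r.2 ≠ (S i).2,
        (1 + c)⁻¹ ^ mistakes S (insert i act) r := by
    rw [mistakeProb, Finset.mul_sum]
    exact Finset.sum_congr rfl fun r _ => mul_div_cancel₀ _ hZ
  rw [mul_add, mul_one, mul_left_comm, this]
  unfold partitionSum
  rw [Finset.sum_congr rfl fun r _ => pow_mistakes_insert hc S hi r, Finset.sum_add_distrib,
    ← Finset.sum_filter, ← Finset.mul_sum]

theorem ruleProb_insert_le (hc : 0 ≤ c) (S : Fin n → X × Bool) {act : Finset (Fin n)} {i : Fin n}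
    (hi : i ∉ act) {avail : Finset ((X → Bool) × Bool)} (hav : avail.Nonempty)
    (r : (X → Bool) × Bool) :
    ruleProb (1 + c)⁻¹ S avail (insert i act) r ≤
      (1 + c * mistakeProb (1 + c)⁻¹ S avail (insert i act) i) *
        ruleProb (1 + c)⁻¹ S avail act r := by
  have hρ : 0 < (1 + c)⁻¹ := by positivity
  have hZ := partitionSum_pos hρ S hav (insert i act)
  have hp := mistakeProb_nonneg hρ S avail (insert i act) i
  have hq : 0 < 1 + c * mistakeProb (1 + c)⁻¹ S avail (insert i act) i := by positivity
  unfold ruleProb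
  rw [partitionSum_eq_insert hc S hi hav, mul_div_assoc', mul_comm (partitionSum _ _ _ _),
    mul_div_mul_left _ _ hq.ne']
  exact div_le_div_of_nonneg_right (pow_mistakes_insert_le hc S hi r) hZ.le

theorem ruleProb_le_insert (hc : 0 ≤ c) (S : Fin n → X × Bool) {act : Finset (Fin n)} {i : Fin n}
    (hi : i ∉ act) {avail : Finset ((X → Bool) × Bool)} (hav : avail.Nonempty)
    (r : (X → Bool) × Bool) :
    ruleProb (1 + c)⁻¹ S avail act r ≤
      (1 + if r.1 (S i).1 = true ∧ r.2 ≠ (S i).2 then c else 0) *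
        ruleProb (1 + c)⁻¹ S avail (insert i act) r := by
  have hρ : 0 < (1 + c)⁻¹ := by positivity
  have hZ := partitionSum_pos hρ S hav (insert i act)
  have hw : (1 + c)⁻¹ ^ mistakes S act r =
      (1 + if r.1 (S i).1 = true ∧ r.2 ≠ (S i).2 then c else 0) *
        (1 + c)⁻¹ ^ mistakes S (insert i act) r := by
    rw [pow_mistakes_insert hc S hi r]
    split_ifs <;> ring
  unfold ruleProb
  rw [mul_div_assoc', ← hw]
  exact div_le_div_of_nonneg_left (by positivity) hZ (partitionSum_insert_le hc S hi avail)

-- No loss accumulates: a rule that leaves `i` active has ratio at most 1, and a rule that mislabels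
-- `i` also covers it, after which the two runs coincide.
open scoped Classical in
theorem greedyProb_le_insert (hc : 0 ≤ c) (S : Fin n → X × Bool) (k : ℕ)
    (avail : Finset ((X → Bool) × Bool)) {act : Finset (Fin n)} {i : Fin n} (hi : i ∉ act)
    (R : Set (X → Bool)) :
    greedyProb (1 + c)⁻¹ S k avail act R ≤
      (1 + c) * greedyProb (1 + c)⁻¹ S k avail (insert i act) R := by
  have hρ : 0 < (1 + c)⁻¹ := by positivity
  induction k generalizing avail act R with
  | zero => unfold greedyProb; split_ifs <;> linarith
  | succ k ih =>
    unfold greedyProb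
    split_ifs with hav
    · rw [Finset.mul_sum]
      refine Finset.sum_le_sum fun r _ => ?_
      have hr := ruleProb_le_insert hc S hi hav r
      have h0 := ruleProb_nonneg hρ S avail (insert i act) r
      cases hcov : r.1 (S i).1
      · rw [survivors_insert_of_not_covers S hcov]
        simp only [hcov, Bool.false_eq_true, false_and, if_false, add_zero, one_mul] at hr
        calc _ ≤ ruleProb (1 + c)⁻¹ S avail (insert i act) r * _ :=
              mul_le_mul hr (ih _ (notMem_survivors S hi r) _)
                (greedyProb_nonneg hρ S _ _ _ _) h0
          _ = _ := by ring
      · rw [survivors_insert_of_covers S hcov, ← mul_assoc]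
        refine mul_le_mul_of_nonneg_right (hr.trans ?_) (greedyProb_nonneg hρ S _ _ _ _)
        refine mul_le_mul_of_nonneg_right ?_ h0
        split_ifs <;> linarith
    all_goals linarith

-- The parameter `b` is a privacy budget that varies in the induction: a round with mistake
-- probability `p` spends `p` of it. The `+ 1` pays for the round in which `i` is covered, whose
-- factor `exp (c * p)` with `p ≤ 1` may exceed the remaining budget.
open scoped Classical in
theorem greedyProb_insert_le (hc : 0 ≤ c) (S : Fin n → X × Bool) (k : ℕ)
    (avail : Finset ((X → Bool) × Bool)) {act : Finset (Fin n)} {i : Fin n} (hi : i ∉ act)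
    (R : Set (X → Bool)) {b : ℝ} (hb : 0 ≤ b) :
    greedyProb (1 + c)⁻¹ S k avail (insert i act) R ≤
      Real.exp (c * (b + 1)) * greedyProb (1 + c)⁻¹ S k avail act R + Real.exp (-b) := by
  have hρ : 0 < (1 + c)⁻¹ := by positivity
  induction k generalizing avail act R b with
  | zero =>
    have h1 : 1 ≤ Real.exp (c * (b + 1)) := Real.one_le_exp (by positivity)
    have h2 := Real.exp_pos (-b)
    unfold greedyProb; split_ifs <;> linarith
  | succ k ih =>
    have h1 : 1 ≤ Real.exp (c * (b + 1)) := Real.one_le_exp (by positivity)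
    have h2 := Real.exp_pos (-b)
    unfold greedyProb
    split_ifs with hav
    · set p := mistakeProb (1 + c)⁻¹ S avail (insert i act) i with hp
      set P := ruleProb (1 + c)⁻¹ S avail (insert i act)
      set Q := ruleProb (1 + c)⁻¹ S avail act
      have hp0 : 0 ≤ p := mistakeProb_nonneg hρ S avail (insert i act) i
      have hP0 : ∀ r, 0 ≤ P r := ruleProb_nonneg hρ S avail (insert i act)
      have hQ0 : ∀ r, 0 ≤ Q r := ruleProb_nonneg hρ S avail act
      have hPQ : ∀ r, P r ≤ Real.exp (c * p) * Q r := fun r =>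
        (ruleProb_insert_le hc S hi hav r).trans
          (mul_le_mul_of_nonneg_right (by linarith [Real.add_one_le_exp (c * p)]) (hQ0 r))
      have hsum : p + ∑ r ∈ avail with r.1 (S i).1 = false, P r ≤ 1 :=
        mistakeProb_add_le_one hρ S hav (insert i act) i
      have hn0 : 0 ≤ ∑ r ∈ avail with r.1 (S i).1 = false, P r :=
        Finset.sum_nonneg fun r _ => hP0 r
      have hp1 : p ≤ 1 := by linarith
      -- the additive loss paid by a rule that does not cover `i`
      obtain ⟨t, ht, hstep⟩ : ∃ t : ℝ, (1 - p) * t ≤ Real.exp (-b) ∧ 0 ≤ t ∧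
          ∀ r ∈ avail, r.1 (S i).1 = false →
          P r * greedyProb (1 + c)⁻¹ S k (avail.erase r) (survivors S (insert i act) r)
            (prependRule r ⁻¹' R) ≤ Real.exp (c * (b + 1)) * (Q r *
              greedyProb (1 + c)⁻¹ S k (avail.erase r) (survivors S act r)
                (prependRule r ⁻¹' R)) + P r * t := by
        rcases le_or_gt p b with hpb | hpb
        -- Enough budget: induct with `b - p`. The additive error grows by `exp p`, offset by the
        -- chance at most `1 - p ≤ exp (-p)` of leaving `i` uncovered.
        · refine ⟨Real.exp (-(b - p)), ?_, (Real.exp_pos _).le, fun r _ hcov => ?_⟩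
          · calc (1 - p) * Real.exp (-(b - p)) ≤ Real.exp (-p) * Real.exp (-(b - p)) :=
                  mul_le_mul_of_nonneg_right (by linarith [Real.add_one_le_exp (-p)])
                    (Real.exp_pos _).le
              _ = Real.exp (-b) := by rw [← Real.exp_add]; ring_nf
          · rw [survivors_insert_of_not_covers S hcov]
            have := ih (avail.erase r) (notMem_survivors S hi r) (prependRule r ⁻¹' R)
              (sub_nonneg.mpr hpb)
            refine (mul_le_mul_of_nonneg_left this (hP0 r)).trans ?_
            rw [mul_add]
            refine add_le_add_left ?_ _
            have hv := greedyProb_nonneg hρ S k (avail.erase r) (survivors S act r)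
              (prependRule r ⁻¹' R)
            generalize greedyProb (1 + c)⁻¹ S k (avail.erase r) (survivors S act r)
              (prependRule r ⁻¹' R) = G at hv ⊢
            calc P r * (Real.exp (c * (b - p + 1)) * G) ≤ (Real.exp (c * p) * Q r) * (Real.exp (c * (b - p + 1)) * G) :=
                  mul_le_mul_of_nonneg_right (hPQ r) (mul_nonneg (Real.exp_pos _).le hv)
              _ = (Real.exp (c * p) * Real.exp (c * (b - p + 1))) * (Q r * G) := by ring
              _ = _ := by rw [← Real.exp_add]; ring_nf
        -- Budget exhausted: leaving `i` uncovered already has probability at most `exp (-p) ≤ exp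
        -- (-b)`, so the trivial bound 1 suffices.
        · refine ⟨1, ?_, zero_le_one, fun r _ _ => ?_⟩
          · rw [mul_one]
            have := Real.add_one_le_exp (-p)
            have : Real.exp (-p) ≤ Real.exp (-b) := Real.exp_le_exp.mpr (by linarith)
            linarith
          · refine le_add_of_nonneg_of_le ?_ ?_
            · exact mul_nonneg (Real.exp_pos _).le
                (mul_nonneg (hQ0 r) (greedyProb_nonneg hρ S _ _ _ _))
            · exact mul_le_mul_of_nonneg_left (greedyProb_le_one hρ S _ _ _ _) (hP0 r)
      have hall : ∀ r ∈ avail,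
          P r * greedyProb (1 + c)⁻¹ S k (avail.erase r) (survivors S (insert i act) r)
            (prependRule r ⁻¹' R) ≤ Real.exp (c * (b + 1)) * (Q r *
              greedyProb (1 + c)⁻¹ S k (avail.erase r) (survivors S act r)
                (prependRule r ⁻¹' R)) + if r.1 (S i).1 = false then P r * t else 0 := by
        intro r hr
        cases hcov : r.1 (S i).1
        · simpa using hstep.2 r hr hcov
        · rw [survivors_insert_of_covers S hcov]
          simp only [Bool.true_eq_false, if_false, add_zero]
          rw [← mul_assoc]
          refine mul_le_mul_of_nonneg_right ((hPQ r).trans ?_) (greedyProb_nonneg hρ S _ _ _ _)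
          refine mul_le_mul_of_nonneg_right (Real.exp_le_exp.mpr ?_) (hQ0 r)
          exact mul_le_mul_of_nonneg_left (by linarith) hc
      refine (Finset.sum_le_sum hall).trans ?_
      rw [Finset.sum_add_distrib, ← Finset.mul_sum, ← Finset.sum_filter, ← Finset.sum_mul]
      refine add_le_add le_rfl (le_trans ?_ ht)
      exact mul_le_mul_of_nonneg_right (by linarith) hstep.1
    all_goals linarith

theorem mistakes_congr {S S' : Fin n → X × Bool} {act : Finset (Fin n)}
    (h : ∀ j ∈ act, S j = S' j) : mistakes S act = mistakes S' act := by
  funext r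
  unfold mistakes
  congr 1
  exact Finset.filter_congr fun j hj => by rw [h j hj]

theorem survivors_congr {S S' : Fin n → X × Bool} {act : Finset (Fin n)}
    (h : ∀ j ∈ act, S j = S' j) : survivors S act = survivors S' act := by
  funext r
  exact Finset.filter_congr fun j hj => by rw [h j hj]

/-- With `i` inactive, two datasets differing only at `i` give the same law. This common run is the
bridge between neighbors. -/
theorem greedyProb_congr (ρ : ℝ) {S S' : Fin n → X × Bool} (k : ℕ)
    (avail : Finset ((X → Bool) × Bool)) {act : Finset (Fin n)} (h : ∀ j ∈ act, S j = S' j)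
    (R : Set (X → Bool)) : greedyProb ρ S k avail act R = greedyProb ρ S' k avail act R := by
  induction k generalizing avail act R with
  | zero => rfl
  | succ k ih =>
    unfold greedyProb
    split_ifs with hav
    · refine Finset.sum_congr rfl fun r _ => ?_
      rw [ih _ (act := survivors S act r) fun j hj => h j (Finset.filter_subset _ _ hj),
        survivors_congr h]
      simp only [ruleProb, partitionSum, mistakes_congr h]
    all_goals rfl

/-- Remove `i` from `S` with budget `b = log (1 / δ)`, at cost `c * (b + 1)` and additive error `δ`;
then insert its replacement from `S'`, at cost one more `c`. -/
theorem isDP_greedyList {ε δ : ℝ} (hc : 0 ≤ c) (hρ : 0 < (1 + c)⁻¹) (hδ : 0 < δ) (hδ' : δ ≤ 1)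
    (hε : c * (Real.log (1 / δ) + 2) ≤ ε) (k : ℕ) (avail : Finset ((X → Bool) × Bool)) :
    IsDP (fun S : Fin n → X × Bool => greedyList hρ S k avail Finset.univ) ε δ := by
  rintro S S' ⟨i, hi⟩ R
  have hlog : 0 ≤ Real.log (1 / δ) := Real.log_nonneg (by rwa [le_div_iff₀ hδ, one_mul])
  have hiU : i ∉ (Finset.univ.erase i : Finset (Fin n)) := Finset.notMem_erase i _
  have hins : (Finset.univ : Finset (Fin n)) = insert i (Finset.univ.erase i) :=
    (Finset.insert_erase (Finset.mem_univ i)).symm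
  have h1 := greedyProb_insert_le hc S k avail hiU R hlog
  have h2 := greedyProb_le_insert hc S' k avail hiU R
  rw [← greedyProb_congr _ k avail (fun j hj => hi j (Finset.ne_of_mem_erase hj))] at h2
  rw [← hins] at h1 h2
  have h3 : Real.exp (-Real.log (1 / δ)) = δ := by
    rw [one_div, Real.log_inv, neg_neg, Real.exp_log hδ]
  have hg := greedyProb_nonneg hρ S' k avail Finset.univ R
  simp only [toOuterMeasure_greedyList]
  rw [← ENNReal.ofReal_mul (Real.exp_pos _).le,
    ← ENNReal.ofReal_add (mul_nonneg (Real.exp_pos _).le hg) hδ.le]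
  refine ENNReal.ofReal_le_ofReal (h1.trans ?_)
  rw [h3]
  refine add_le_add ?_ le_rfl
  calc _ ≤ Real.exp (c * (Real.log (1 / δ) + 1)) *
        ((1 + c) * greedyProb (1 + c)⁻¹ S' k avail Finset.univ R) :=
        mul_le_mul_of_nonneg_left h2 (Real.exp_pos _).le
    _ ≤ Real.exp (c * (Real.log (1 / δ) + 1)) *
        (Real.exp c * greedyProb (1 + c)⁻¹ S' k avail Finset.univ R) := by
        refine mul_le_mul_of_nonneg_left (mul_le_mul_of_nonneg_right ?_ hg) (Real.exp_pos _).le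
        linarith [Real.add_one_le_exp c]
    _ = Real.exp (c * (Real.log (1 / δ) + 2)) *
        greedyProb (1 + c)⁻¹ S' k avail Finset.univ R := by
        rw [← mul_assoc, ← Real.exp_add]; ring_nf
    _ ≤ _ := mul_le_mul_of_nonneg_right (Real.exp_le_exp.mpr hε) hg

end Privacy

/-! ### Empirical accuracy of the greedy list -/

section Utility

variable {X : Type*} {n : ℕ}

theorem greedyProb_mono {ρ : ℝ} (hρ : 0 < ρ) (S : Fin n → X × Bool) (k : ℕ)
    (avail : Finset ((X → Bool) × Bool)) (act : Finset (Fin n)) {R R' : Set (X → Bool)}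
    (h : R ⊆ R') : greedyProb ρ S k avail act R ≤ greedyProb ρ S k avail act R' := by
  induction k generalizing avail act R R' with
  | zero =>
    unfold greedyProb
    split_ifs with h1 h2
    · exact le_rfl
    · exact absurd (h h1) h2
    all_goals norm_num
  | succ k ih =>
    unfold greedyProb
    split_ifs with hav h1 h2
    · exact Finset.sum_le_sum fun r _ => mul_le_mul_of_nonneg_left
        (ih _ _ (Set.preimage_mono h)) (ruleProb_nonneg hρ S avail act r)
    · exact le_rfl
    · exact absurd (h h1) h2
    all_goals norm_num

open scoped Classical in
/-- The hypotheses computed by decision lists with `k` rules from `F` and default `false`. -/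
noncomputable def listHypotheses (F : Finset ((X → Bool) × Bool)) : ℕ → Finset (X → Bool)
  | 0 => {fun _ => false}
  | k + 1 => Finset.image₂ prependRule F (listHypotheses F k)

theorem card_listHypotheses_le (F : Finset ((X → Bool) × Bool)) (k : ℕ) :
    (listHypotheses F k).card ≤ F.card ^ k := by
  classical
  induction k with
  | zero => simp [listHypotheses]
  | succ k ih =>
    unfold listHypotheses
    refine (Finset.card_image₂_le _ _ _).trans ?_
    rw [pow_succ']
    exact Nat.mul_le_mul_left _ ih

/-- The number of active examples that `h` mislabels. -/
def errorCount (S : Fin n → X × Bool) (act : Finset (Fin n)) (h : X → Bool) : ℕ :=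
  (act.filter fun i => h (S i).1 ≠ (S i).2).card

theorem errorCount_prependRule (S : Fin n → X × Bool) (act : Finset (Fin n))
    (r : (X → Bool) × Bool) (h : X → Bool) :
    errorCount S act (prependRule r h) = mistakes S act r + errorCount S (survivors S act r) h := by
  unfold errorCount mistakes survivors
  rw [← Finset.card_union_of_disjoint]
  · congr 1
    ext i
    simp only [Finset.mem_union, Finset.mem_filter]
    cases hr : r.1 (S i).1 <;> simp [prependRule, hr]
  · rw [Finset.disjoint_left]
    intro i hi hi'
    simp_all

/-- A decision list with rules from `avail` that labels every active example correctly without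
reaching its default. -/
def Realizable (S : Fin n → X × Bool) (avail : Finset ((X → Bool) × Bool))
    (act : Finset (Fin n)) : Prop :=
  ∃ L : List ((X → Bool) × Bool), (∀ p ∈ L, p ∈ avail) ∧
    ∀ i ∈ act, ∀ b, evalList L b (S i).1 = (S i).2

open scoped Classical in
theorem evalList_filter_ne (L : List ((X → Bool) × Bool)) {r : (X → Bool) × Bool} {x : X}
    (hr : r.1 x = false) (b : Bool) : evalList (L.filter (· ≠ r)) b x = evalList L b x := by
  induction L with
  | nil => rfl
  | cons p L ih =>
    rw [List.filter_cons]
    by_cases hp : p = r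
    · subst hp
      simp [evalList, hr, ← ih]
    · simp [hp, evalList, ← ih]

-- Survivors are not covered by `r`, so deleting `r` from a consistent list changes nothing on them.
open scoped Classical in
theorem Realizable.survivors {S : Fin n → X × Bool} {avail : Finset ((X → Bool) × Bool)}
    {act : Finset (Fin n)} (h : Realizable S avail act) (r : (X → Bool) × Bool) :
    Realizable S (avail.erase r) (survivors S act r) := by
  obtain ⟨L, hL, hS⟩ := h
  refine ⟨L.filter (· ≠ r), fun p hp => ?_, fun i hi b => ?_⟩
  · rw [List.mem_filter] at hp
    exact Finset.mem_erase.mpr ⟨by simpa using hp.2, hL p hp.1⟩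
  · obtain ⟨hi, hr⟩ := Finset.mem_filter.mp hi
    rw [evalList_filter_ne L hr, hS i hi]

/-- The first rule of a consistent list is correct wherever it fires. An empty list forces the
active set to be empty, since its value would depend on the default. -/
theorem Realizable.exists_mistakes_eq_zero {S : Fin n → X × Bool}
    {avail : Finset ((X → Bool) × Bool)} {act : Finset (Fin n)} (h : Realizable S avail act)
    (hav : avail.Nonempty) : ∃ r ∈ avail, mistakes S act r = 0 := by
  obtain ⟨L, hL, hS⟩ := h
  rcases L with _ | ⟨p, L⟩
  · obtain ⟨r, hr⟩ := hav
    refine ⟨r, hr, ?_⟩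
    unfold mistakes
    rw [Finset.card_eq_zero, Finset.filter_eq_empty_iff]
    intro i hi
    have h1 := hS i hi true
    have h2 := hS i hi false
    simp only [evalList] at h1 h2
    exact absurd (h1.trans h2.symm) (by simp)
  · refine ⟨p, hL p List.mem_cons_self, ?_⟩
    unfold mistakes
    rw [Finset.card_eq_zero, Finset.filter_eq_empty_iff]
    rintro i hi ⟨h1, h2⟩
    have := hS i hi true
    rw [evalList, if_pos h1] at this
    exact h2 this

theorem ruleProb_le_pow {ρ : ℝ} (hρ : 0 < ρ) (hρ1 : ρ ≤ 1) {S : Fin n → X × Bool}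
    {avail : Finset ((X → Bool) × Bool)} {act : Finset (Fin n)}
    (hz : ∃ r ∈ avail, mistakes S act r = 0) {s : ℕ} {r : (X → Bool) × Bool}
    (hr : s ≤ mistakes S act r) : ruleProb ρ S avail act r ≤ ρ ^ s := by
  obtain ⟨r₀, h₀, hm⟩ := hz
  have hZ : 1 ≤ partitionSum ρ S avail act := by
    have := Finset.single_le_sum (f := fun r => ρ ^ mistakes S act r)
      (fun r _ => (pow_pos hρ _).le) h₀
    simpa [hm, partitionSum] using this
  exact (div_le_self (pow_pos hρ _).le hZ).trans (pow_le_pow_of_le_one hρ.le hρ1 hr)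

/-- The event that a hypothesis is not a decision list with `k` rules from `F` or mislabels more
than `k * s` active examples. -/
def failureSet (F : Finset ((X → Bool) × Bool)) (S : Fin n → X × Bool) (s k : ℕ)
    (act : Finset (Fin n)) : Set (X → Bool) :=
  {h | h ∉ listHypotheses F k ∨ k * s < errorCount S act h}

theorem preimage_failureSet_subset {F : Finset ((X → Bool) × Bool)} (S : Fin n → X × Bool)
    {s : ℕ} (k : ℕ) (act : Finset (Fin n)) {r : (X → Bool) × Bool} (hr : r ∈ F)
    (hs : mistakes S act r ≤ s) :
    prependRule r ⁻¹' failureSet F S s (k + 1) act ⊆ failureSet F S s k (survivors S act r) := by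
  classical
  rintro h (h1 | h1)
  · exact Or.inl fun h2 => h1 (Finset.mem_image₂_of_mem hr h2)
  · right
    rw [errorCount_prependRule] at h1
    nlinarith

/-- A union bound over rounds and rules. Running until no rule is left matters: realizability with
no rules leaves no active example, so the default of the learned list costs nothing. -/
theorem greedyProb_failureSet_le {ρ : ℝ} (hρ : 0 < ρ) (hρ1 : ρ ≤ 1)
    (F : Finset ((X → Bool) × Bool)) (S : Fin n → X × Bool) (s k : ℕ)
    (avail : Finset ((X → Bool) × Bool)) (act : Finset (Fin n)) (hF : avail ⊆ F)
    (hk : avail.card = k) (hreal : Realizable S avail act) :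
    greedyProb ρ S k avail act (failureSet F S s k act) ≤ k * (F.card * ρ ^ s) := by
  classical
  induction k generalizing avail act with
  | zero =>
    obtain rfl : avail = ∅ := Finset.card_eq_zero.mp hk
    obtain ⟨L, hL, hS⟩ := hreal
    obtain rfl : L = [] := List.eq_nil_iff_forall_not_mem.mpr fun p hp => by simpa using hL p hp
    obtain rfl : act = ∅ := Finset.eq_empty_of_forall_notMem fun i hi =>
      absurd ((hS i hi true).trans (hS i hi false).symm) (by simp [evalList])
    unfold greedyProb
    rw [if_neg]
    · simp
    · simp [failureSet, listHypotheses, errorCount]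
  | succ k ih =>
    have hav : avail.Nonempty := Finset.card_pos.mp (by omega)
    have hz := hreal.exists_mistakes_eq_zero hav
    set η : ℝ := F.card * ρ ^ s with hη
    have hη0 : 0 ≤ η := by positivity
    unfold greedyProb
    rw [if_pos hav]
    have hstep : ∀ r ∈ avail, ruleProb ρ S avail act r *
        greedyProb ρ S k (avail.erase r) (survivors S act r)
          (prependRule r ⁻¹' failureSet F S s (k + 1) act) ≤
        ρ ^ s + ruleProb ρ S avail act r * (k * η) := by
      intro r hr
      have h0 := ruleProb_nonneg hρ S avail act r
      rcases le_or_gt (mistakes S act r) s with hs | hs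
      · refine le_add_of_nonneg_of_le (pow_pos hρ _).le (mul_le_mul_of_nonneg_left ?_ h0)
        refine (greedyProb_mono hρ S k _ _
          (preimage_failureSet_subset S k act (hF hr) hs)).trans ?_
        refine ih _ _ ((Finset.erase_subset _ _).trans hF) ?_ (hreal.survivors r)
        rw [Finset.card_erase_of_mem hr, hk, Nat.add_sub_cancel]
      · refine le_add_of_le_of_nonneg ?_ (mul_nonneg h0 (by positivity))
        exact (mul_le_of_le_one_right h0 (greedyProb_le_one hρ S _ _ _ _)).trans
          (ruleProb_le_pow hρ hρ1 hz hs.le)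
    refine (Finset.sum_le_sum hstep).trans ?_
    rw [Finset.sum_add_distrib, ← Finset.sum_mul, sum_ruleProb hρ S hav, one_mul,
      Finset.sum_const, nsmul_eq_mul]
    have : (avail.card : ℝ) * ρ ^ s ≤ η :=
      mul_le_mul_of_nonneg_right (by exact_mod_cast Finset.card_le_card hF) (pow_pos hρ _).le
    push_cast
    linarith

end Utility

/-! ### From empirical to true error -/

section Generalization

variable {X : Type*} [Finite X] [MeasurableSpace X] [MeasurableSingletonClass X] {n : ℕ}

/-- A Chernoff bound: a hypothesis of error more than `α` rarely makes few errors on a sample. -/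
theorem measure_errorCount_le (D : Measure X) [IsProbabilityMeasure D] (c h : X → Bool) {α t : ℝ}
    (hα : 0 ≤ α) (hh : ENNReal.ofReal α < err D c h) :
    (Measure.pi fun _ : Fin n => D) {x | (errorCount (fun i => (x i, c (x i))) Finset.univ h : ℝ) ≤ t}
      ≤ ENNReal.ofReal (Real.exp (t - n * α / 2)) := by
  classical
  -- The moment generating function at `-1`; since `exp (-1) ≤ 1 / 2`, its mean is at most `1 - α /
  -- 2 ≤ exp (-(α / 2))`.
  set g : X → ℝ := fun x => if c x ≠ h x then Real.exp (-1) else 1 with hg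
  set μ := Measure.pi fun _ : Fin n => D
  set p : ℝ := D.real {x | c x ≠ h x} with hp
  have hαp : α ≤ p := by
    have := ENNReal.toReal_mono (measure_ne_top D _) hh.le
    rwa [ENNReal.toReal_ofReal hα] at this
  have hgint : ∫ x, g x ∂D = 1 - (1 - Real.exp (-1)) * p := by
    have hg' : g = fun x => 1 - (1 - Real.exp (-1)) * ({x | c x ≠ h x}.indicator 1 x : ℝ) := by
      funext x
      by_cases hx : c x = h x <;> simp [hg, hx]
    rw [hg', integral_sub (integrable_const _) Integrable.of_finite, integral_const_mul,
      integral_indicator_one (Set.toFinite _).measurableSet]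
    simp [hp]
  have he : Real.exp (-1) ≤ 1 / 2 := by
    have := Real.add_one_le_exp (1 : ℝ)
    rw [Real.exp_neg, ← one_div]
    exact one_div_le_one_div_of_le (by norm_num) (by linarith)
  have hgle : ∫ x, g x ∂D ≤ Real.exp (-(α / 2)) := by
    rw [hgint]
    refine le_trans ?_ (Real.add_one_le_exp _)
    nlinarith
  have hg0 : 0 ≤ ∫ x, g x ∂D := integral_nonneg fun x => by
    simp only [hg]; split_ifs <;> simp [Real.exp_nonneg]
  have hprod : ∀ x : Fin n → X, ∏ i, g (x i) =
      Real.exp (-(errorCount (fun i => (x i, c (x i))) Finset.univ h : ℝ)) := by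
    intro x
    simp only [hg, errorCount]
    rw [Finset.prod_ite, Finset.prod_const, Finset.prod_const_one, mul_one, ← Real.exp_nat_mul,
      mul_neg_one]
    simp only [ne_comm]
  have hmarkov := mul_meas_ge_le_integral_of_nonneg (μ := μ) (f := fun x => ∏ i, g (x i))
    (Filter.Eventually.of_forall fun x => by simp only [hprod]; exact (Real.exp_pos _).le)
    Integrable.of_finite (Real.exp (-t))
  rw [integral_fintype_prod_eq_pow, Fintype.card_fin] at hmarkov
  have hset : {x : Fin n → X | (errorCount (fun i => (x i, c (x i))) Finset.univ h : ℝ) ≤ t} =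
      {x | Real.exp (-t) ≤ ∏ i, g (x i)} := by
    ext x
    simp [hprod]
  rw [hset, ← ofReal_measureReal]
  refine ENNReal.ofReal_le_ofReal ?_
  have h1 : Real.exp (-t) * μ.real {x | Real.exp (-t) ≤ ∏ i, g (x i)} ≤
      Real.exp (-(n * α / 2)) := by
    refine hmarkov.trans ((pow_le_pow_left₀ hg0 hgle n).trans ?_)
    rw [← Real.exp_nat_mul]
    exact le_of_eq (by ring_nf)
  calc _ = Real.exp t * (Real.exp (-t) * μ.real {x | Real.exp (-t) ≤ ∏ i, g (x i)}) := by
        rw [← mul_assoc, ← Real.exp_add]; simp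
    _ ≤ Real.exp t * Real.exp (-(n * α / 2)) := mul_le_mul_of_nonneg_left h1 (Real.exp_pos _).le
    _ = _ := by rw [← Real.exp_add]; ring_nf

/-- A uniform convergence bound over a finite class. -/
theorem measure_exists_errorCount_le (D : Measure X) [IsProbabilityMeasure D] (c : X → Bool)
    (H : Finset (X → Bool)) {α t : ℝ} (hα : 0 ≤ α) :
    (Measure.pi fun _ : Fin n => D) {x | ∃ h ∈ H, ENNReal.ofReal α < err D c h ∧
      (errorCount (fun i => (x i, c (x i))) Finset.univ h : ℝ) ≤ t} ≤
      ENNReal.ofReal (H.card * Real.exp (t - n * α / 2)) := by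
  have hsub : {x : Fin n → X | ∃ h ∈ H, ENNReal.ofReal α < err D c h ∧
      (errorCount (fun i => (x i, c (x i))) Finset.univ h : ℝ) ≤ t} ⊆
      ⋃ h ∈ H, {x | ENNReal.ofReal α < err D c h ∧
        (errorCount (fun i => (x i, c (x i))) Finset.univ h : ℝ) ≤ t} := by
    rintro x ⟨h, hH, hx⟩
    exact Set.mem_biUnion hH hx
  refine (measure_mono hsub).trans ((measure_biUnion_finset_le _ _).trans ?_)
  rw [ENNReal.ofReal_mul (Nat.cast_nonneg _), ENNReal.ofReal_natCast, ← nsmul_eq_mul,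
    ← Finset.sum_const]
  refine Finset.sum_le_sum fun h _ => ?_
  by_cases hh : ENNReal.ofReal α < err D c h
  · refine (measure_mono fun x hx => ?_).trans (measure_errorCount_le (t := t) D c h hα hh)
    exact hx.2
  · simp [hh]

theorem isPAC_greedyList {ρ : ℝ} (hρ : 0 < ρ) (hρ1 : ρ ≤ 1) (F : Finset ((X → Bool) × Bool))
    {C : Set (X → Bool)} (hC : ∀ c ∈ C, ∃ L : List ((X → Bool) × Bool), (∀ p ∈ L, p ∈ F) ∧
      ∀ b, evalList L b = c) {s : ℕ} {α β : ℝ} (hα : 0 ≤ α) (hβ : β ≤ 1)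
    (hsel : F.card * (F.card * ρ ^ s) ≤ β / 2)
    (hgen : (F.card : ℝ) ^ F.card * Real.exp ((F.card * s : ℕ) - n * α / 2) ≤ β / 2) :
    IsPAC (fun S : Fin n → X × Bool => greedyList hρ S F.card F Finset.univ) C α β := by
  intro D _ c hc
  set μ := Measure.pi fun _ : Fin n => D
  -- The misleading samples. Off `B`, an output with large true error must lie in `failureSet`.
  set B : Set (Fin n → X) := {x | ∃ h ∈ listHypotheses F F.card, ENNReal.ofReal α < err D c h ∧
      (errorCount (fun i => (x i, c (x i))) Finset.univ h : ℝ) ≤ (F.card * s : ℕ)}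
  have hB : μ B ≤ ENNReal.ofReal (β / 2) := by
    refine (measure_exists_errorCount_le D c _ hα).trans (ENNReal.ofReal_le_ofReal (le_trans ?_ hgen))
    refine mul_le_mul_of_nonneg_right ?_ (Real.exp_pos _).le
    exact_mod_cast card_listHypotheses_le F F.card
  have hBc : ENNReal.ofReal (1 - β / 2) ≤ μ Bᶜ := by
    rw [prob_compl_eq_one_sub (Set.toFinite B).measurableSet]
    have hβ0 : 0 ≤ β / 2 := le_trans (by positivity) hgen
    rw [ENNReal.ofReal_sub _ hβ0, ENNReal.ofReal_one]
    exact tsub_le_tsub_left hB 1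
  have hpoint : ∀ x ∈ Bᶜ, ENNReal.ofReal (1 - β / 2) ≤
      (greedyList hρ (fun i => (x i, c (x i))) F.card F Finset.univ).toOuterMeasure
        {h | err D c h ≤ ENNReal.ofReal α} := by
    intro x hx
    set S : Fin n → X × Bool := fun i => (x i, c (x i))
    set p := greedyList hρ S F.card F Finset.univ
    have hreal : Realizable S F Finset.univ := by
      obtain ⟨L, hL, hLc⟩ := hC c hc
      exact ⟨L, hL, fun i _ b => by rw [hLc b]⟩
    have hfail : p.toOuterMeasure (failureSet F S s F.card Finset.univ) ≤
        ENNReal.ofReal (β / 2) := by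
      rw [toOuterMeasure_greedyList]
      exact ENNReal.ofReal_le_ofReal ((greedyProb_failureSet_le hρ hρ1 F S s F.card F Finset.univ
        subset_rfl rfl hreal).trans hsel)
    have hcover : Set.univ ⊆ {h | err D c h ≤ ENNReal.ofReal α} ∪
        failureSet F S s F.card Finset.univ := by
      intro h _
      by_contra hcon
      simp only [Set.mem_union, Set.mem_ofPred_eq, failureSet, not_or, not_le, not_not,
        not_lt] at hcon
      exact hx ⟨h, hcon.2.1, hcon.1, by exact_mod_cast hcon.2.2⟩
    have hone : 1 ≤ p.toOuterMeasure {h | err D c h ≤ ENNReal.ofReal α} +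
        ENNReal.ofReal (β / 2) := by
      calc (1 : ℝ≥0∞) = p.toOuterMeasure Set.univ :=
            ((p.toOuterMeasure_apply_eq_one_iff _).mpr (Set.subset_univ _)).symm
        _ ≤ _ := p.toOuterMeasure.mono hcover
        _ ≤ _ := measure_union_le _ _
        _ ≤ _ := add_le_add le_rfl hfail
    have hβ0 : 0 ≤ β / 2 := le_trans (by positivity) hgen
    rw [ENNReal.ofReal_sub _ hβ0, ENNReal.ofReal_one]
    exact tsub_le_iff_right.mpr hone
  have hβ0 : 0 ≤ β / 2 := le_trans (by positivity) hgen
  calc ENNReal.ofReal (1 - β) ≤ ENNReal.ofReal (1 - β / 2) * ENNReal.ofReal (1 - β / 2) := by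
        rw [← ENNReal.ofReal_mul (by linarith)]
        exact ENNReal.ofReal_le_ofReal (by nlinarith)
    _ ≤ ENNReal.ofReal (1 - β / 2) * μ Bᶜ := mul_le_mul_right hBc _
    _ = ∫⁻ _ in Bᶜ, ENNReal.ofReal (1 - β / 2) ∂μ := by rw [setLIntegral_const]
    _ ≤ ∫⁻ x in Bᶜ, (greedyList hρ (fun i => (x i, c (x i))) F.card F Finset.univ).toOuterMeasure
        {h | err D c h ≤ ENNReal.ofReal α} ∂μ :=
        setLIntegral_mono (measurable_of_finite _) hpoint
    _ ≤ _ := setLIntegral_le_lintegral _ _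

end Generalization

/-! ### Choice of parameters and sample size -/

section SampleComplexity

/-- All rules whose feature is a conjunction of at most `k` literals. -/
noncomputable def conjunctionRules (d k : ℕ) : Finset (((Fin d → Bool) → Bool) × Bool) :=
  (Set.toFinite (conjunctions d k)).toFinset ×ˢ Finset.univ

theorem card_conjunctionRules (d k : ℕ) :
    (conjunctionRules d k).card = 2 * (conjunctions d k).ncard := by
  rw [conjunctionRules, Finset.card_product, Set.ncard_eq_toFinset_card _ (Set.toFinite _),
    Finset.card_univ, Fintype.card_bool, mul_comm]

theorem mem_conjunctionRules {d k : ℕ} {p : ((Fin d → Bool) → Bool) × Bool} :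
    p ∈ conjunctionRules d k ↔ p.1 ∈ conjunctions d k := by
  simp [conjunctionRules]

theorem const_true_mem_conjunctions (d k : ℕ) : (fun _ => true) ∈ conjunctions d k :=
  ⟨∅, by simp, by funext x; simp [conjunction]⟩

theorem evalList_append_const_true {X : Type*} (L : List ((X → Bool) × Bool)) (b b' : Bool) :
    evalList (L ++ [(fun _ => true, b)]) b' = evalList L b := by
  funext x
  induction L with
  | nil => simp [evalList]
  | cons p L ih => simp [evalList, ih]

/-- The default becomes a final rule with the empty conjunction, so the target never reaches a
default. -/
theorem exists_rules_of_mem_kDecisionLists {d k : ℕ} {c : (Fin d → Bool) → Bool}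
    (hc : c ∈ kDecisionLists d k) : ∃ L : List (((Fin d → Bool) → Bool) × Bool),
      (∀ p ∈ L, p ∈ conjunctionRules d k) ∧ ∀ b, evalList L b = c := by
  obtain ⟨r, b, hr, rfl⟩ := hc
  refine ⟨r ++ [(fun _ => true, b)], fun p hp => ?_, evalList_append_const_true r b⟩
  rw [mem_conjunctionRules]
  rcases List.mem_append.mp hp with hp | hp
  · exact hr p hp
  · rw [List.mem_singleton.mp hp]
    exact const_true_mem_conjunctions d k

theorem one_le_card_conjunctionRules (d k : ℕ) : 1 ≤ (conjunctionRules d k).card :=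
  Finset.card_pos.mpr ⟨(fun _ => true, true),
    mem_conjunctionRules.mpr (const_true_mem_conjunctions d k)⟩

variable {N : ℕ} {β : ℝ}

theorem log_confidence_pos (hN : 1 ≤ N) (hβ : 0 < β) (hβ1 : β ≤ 1) :
    0 < Real.log (2 * N ^ 2 / β) := by
  have hN' : (1 : ℝ) ≤ N := by exact_mod_cast hN
  refine Real.log_pos ?_
  rw [lt_div_iff₀ hβ]
  nlinarith

theorem exp_neg_log_confidence (hN : 1 ≤ N) (hβ : 0 < β) :
    Real.exp (-Real.log (2 * N ^ 2 / β)) = β / (2 * N ^ 2) := by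
  have hN' : (1 : ℝ) ≤ N := by exact_mod_cast hN
  rw [← Real.log_inv, Real.exp_log (by positivity), inv_div]

theorem selection_failure_le (hN : 1 ≤ N) (hβ : 0 < β) {c : ℝ} (hc : 0 < c) {s : ℕ}
    (hs : Real.log (2 * N ^ 2 / β) / Real.log (1 + c) ≤ s) :
    N * (N * (1 + c)⁻¹ ^ s) ≤ β / 2 := by
  have hN' : (1 : ℝ) ≤ N := by exact_mod_cast hN
  have hlog : 0 < Real.log (1 + c) := Real.log_pos (by linarith)
  have hpow : (1 + c)⁻¹ ^ s ≤ β / (2 * N ^ 2) := by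
    rw [← exp_neg_log_confidence hN hβ, ← Real.exp_log (x := (1 + c)⁻¹) (by positivity),
      ← Real.exp_nat_mul, Real.log_inv]
    rw [div_le_iff₀ hlog] at hs
    exact Real.exp_le_exp.mpr (by linarith)
  calc N * (N * (1 + c)⁻¹ ^ s) ≤ N * (N * (β / (2 * N ^ 2))) := by gcongr
    _ = β / 2 := by field_simp

/-- Of the `n * α / 2` in the exponent, `N * s` pays for the empirical errors and `N * log (2 * N^2
/ β)` for the `N^N` hypotheses. -/
theorem generalization_failure_le (hN : 1 ≤ N) (hβ : 0 < β) (hβ1 : β ≤ 1) {α : ℝ} (hα : 0 < α)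
    {s n : ℕ} (hn : 2 * N * (s + Real.log (2 * N ^ 2 / β)) / α ≤ n) :
    (N : ℝ) ^ N * Real.exp ((N * s : ℕ) - n * α / 2) ≤ β / 2 := by
  have hN' : (1 : ℝ) ≤ N := by exact_mod_cast hN
  rw [div_le_iff₀ hα] at hn
  have hexp : Real.exp ((N * s : ℕ) - n * α / 2) ≤ (β / (2 * N ^ 2)) ^ N := by
    rw [← exp_neg_log_confidence hN hβ, ← Real.exp_nat_mul]
    refine Real.exp_le_exp.mpr ?_
    push_cast
    linarith
  calc (N : ℝ) ^ N * Real.exp ((N * s : ℕ) - n * α / 2)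
      ≤ (N : ℝ) ^ N * (β / (2 * N ^ 2)) ^ N := by gcongr
    _ = (β / (2 * N)) ^ N := by rw [← mul_pow]; congr 1; field_simp
    _ ≤ β / (2 * N) := by
        refine pow_le_of_le_one (by positivity) ?_ (by omega)
        rw [div_le_one (by positivity)]
        linarith
    _ ≤ β / 2 := div_le_div_of_nonneg_left hβ.le (by norm_num) (by linarith)

theorem log_confidence_le {P β₀ : ℝ} (hN : 1 ≤ N) (hP : 1 ≤ P)
    (hNP : (N : ℝ) ≤ 2 * Real.exp 2 * P) (hβ : 0 < β) (hβ0 : β ≤ β₀) (hβ1 : β₀ < 1) :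
    Real.log (2 * N ^ 2 / β) ≤
      (Real.log (8 * Real.exp 2 ^ 2) / Real.log (1 / β₀) + 2) * Real.log (P / β) := by
  have hN' : (1 : ℝ) ≤ N := by exact_mod_cast hN
  have hβ₀ : 0 < β₀ := hβ.trans_le hβ0
  have he : 1 ≤ Real.exp 2 := Real.one_le_exp (by norm_num)
  have hΛ₀ : 0 < Real.log (1 / β₀) := Real.log_pos (by rwa [lt_div_iff₀ hβ₀, one_mul])
  have hΛ : Real.log (1 / β₀) ≤ Real.log (P / β) :=
    Real.log_le_log (by positivity) (div_le_div₀ (by linarith) hP hβ hβ0)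
  have hA : 0 ≤ Real.log (8 * Real.exp 2 ^ 2) := Real.log_nonneg (by nlinarith)
  calc Real.log (2 * N ^ 2 / β) ≤ Real.log (8 * Real.exp 2 ^ 2 * (P / β) ^ 2) := by
        refine Real.log_le_log (by positivity) ?_
        rw [div_pow, mul_div_assoc']
        refine div_le_div₀ (by positivity) ?_ (by positivity) ?_
        · calc 2 * (N : ℝ) ^ 2 ≤ 2 * (2 * Real.exp 2 * P) ^ 2 := by gcongr
            _ = _ := by ring
        · nlinarith
    _ = Real.log (8 * Real.exp 2 ^ 2) + 2 * Real.log (P / β) := by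
        rw [Real.log_mul (by positivity) (by positivity), Real.log_pow]
        norm_num
    _ ≤ _ := by
        rw [add_mul]
        refine add_le_add ?_ le_rfl
        rw [div_mul_eq_mul_div, le_div_iff₀ hΛ₀]
        exact mul_le_mul_of_nonneg_left hΛ hA

theorem inv_log_one_add_le {ε ε₀ ℓ ℓ₀ : ℝ} (hε : 0 < ε) (hε0 : ε ≤ ε₀) (hℓ₀ : 0 < ℓ₀)
    (hℓ : ℓ₀ ≤ ℓ) :
    1 / Real.log (1 + ε / (ℓ + 2)) ≤ (1 + ε₀) * (1 + 2 / ℓ₀) * (ℓ / ε) := by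
  have hℓ' : 0 < ℓ := hℓ₀.trans_le hℓ
  set c := ε / (ℓ + 2) with hc
  have hc0 : 0 < c := by positivity
  have hcε : c ≤ ε₀ := (div_le_self hε.le (by linarith)).trans hε0
  have hlog : c / (1 + c) ≤ Real.log (1 + c) := by
    refine le_trans (le_of_eq ?_) (Real.one_sub_inv_le_log_of_pos (by positivity))
    field_simp
    ring
  calc 1 / Real.log (1 + c) ≤ 1 / (c / (1 + c)) :=
        one_div_le_one_div_of_le (by positivity) hlog
    _ = (1 + c) * ((ℓ + 2) / ε) := by rw [one_div_div, hc]; field_simp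
    _ ≤ (1 + ε₀) * ((ℓ + 2 * (ℓ / ℓ₀)) / ε) := by
        have : 1 ≤ ℓ / ℓ₀ := (one_le_div hℓ₀).mpr hℓ
        gcongr
        all_goals linarith
    _ = _ := by ring

theorem exists_sampleSize {ε₀ δ₀ β₀ : ℝ} (hε₀ : 0 < ε₀) (hδ₀ : 0 < δ₀) (hδ₀1 : δ₀ < 1)
    (hβ₀ : 0 < β₀) (hβ₀1 : β₀ < 1) :
    ∃ K : ℝ, 0 < K ∧ ∀ (N : ℕ) (P ε δ α β : ℝ), 1 ≤ N → 1 ≤ P → (N : ℝ) ≤ 2 * Real.exp 2 * P →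
      0 < ε → ε ≤ ε₀ → 0 < δ → δ ≤ δ₀ → 0 < α → α ≤ 1 → 0 < β → β ≤ β₀ →
      ∃ s m : ℕ, Real.log (2 * N ^ 2 / β) / Real.log (1 + ε / (Real.log (1 / δ) + 2)) ≤ s ∧
        2 * N * (s + Real.log (2 * N ^ 2 / β)) / α ≤ m ∧
        (m : ℝ) ≤ K * (P * Real.log (P / β) * Real.log (1 / δ) / (α * ε)) := by
  set Λ₀ := Real.log (1 / β₀) with hΛ₀
  set ℓ₀ := Real.log (1 / δ₀) with hℓ₀
  have hΛ₀0 : 0 < Λ₀ := Real.log_pos (by rwa [lt_div_iff₀ hβ₀, one_mul])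
  have hℓ₀0 : 0 < ℓ₀ := Real.log_pos (by rwa [lt_div_iff₀ hδ₀, one_mul])
  have he : 1 ≤ Real.exp 2 := Real.one_le_exp (by norm_num)
  have hA : 0 ≤ Real.log (8 * Real.exp 2 ^ 2) := Real.log_nonneg (by nlinarith)
  set K₁ := Real.log (8 * Real.exp 2 ^ 2) / Λ₀ + 2 with hK₁
  set K₂ := (1 + ε₀) * (1 + 2 / ℓ₀) with hK₂
  set K₃ := ε₀ / (Λ₀ * ℓ₀) with hK₃
  have hK₁0 : 0 < K₁ := by positivity
  have hK₂0 : 0 < K₂ := by positivity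
  have hK₃0 : 0 < K₃ := by positivity
  -- In the bracket: `x`, the rounding of `s`, and `L`. The last `K₃` is the rounding of `m`.
  refine ⟨4 * Real.exp 2 * (K₁ * K₂ + K₃ + K₁ * (ε₀ / ℓ₀)) + K₃, by positivity, ?_⟩
  intro N P ε δ α β hN hP hNP hε hεε₀ hδ hδδ₀ hα hα1 hβ hββ₀
  set L := Real.log (2 * N ^ 2 / β)
  set ℓ := Real.log (1 / δ)
  set Λ := Real.log (P / β)
  have hℓ : ℓ₀ ≤ ℓ := Real.log_le_log (by positivity) (one_div_le_one_div_of_le hδ hδδ₀)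
  have hΛ : Λ₀ ≤ Λ := Real.log_le_log (by positivity) (div_le_div₀ (by linarith) hP hβ hββ₀)
  have hℓ0 : 0 < ℓ := hℓ₀0.trans_le hℓ
  have hΛ0 : 0 < Λ := hΛ₀0.trans_le hΛ
  have hL0 : 0 < L := log_confidence_pos hN hβ (hββ₀.trans hβ₀1.le)
  have hL : L ≤ K₁ * Λ := log_confidence_le hN hP hNP hβ hββ₀ hβ₀1
  have hc : 0 < Real.log (1 + ε / (ℓ + 2)) := Real.log_pos (lt_add_of_pos_right _ (by positivity))
  set x := L / Real.log (1 + ε / (ℓ + 2)) with hx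
  have hx0 : 0 < x := by positivity
  set T := Λ * ℓ / ε with hT
  have hT0 : 0 < T := by positivity
  have hxT : x ≤ K₁ * K₂ * T := by
    calc x = L * (1 / Real.log (1 + ε / (ℓ + 2))) := by rw [hx]; ring
      _ ≤ (K₁ * Λ) * (K₂ * (ℓ / ε)) :=
        mul_le_mul hL (inv_log_one_add_le hε hεε₀ hℓ₀0 hℓ) (by positivity) (by positivity)
      _ = _ := by rw [hT]; ring
  -- The fixed bounds on `ε` and `δ` keep `ℓ / ε` away from 0, so `L` and the rounding errors are
  -- absorbed into multiples of `T`.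
  have hℓε : 1 ≤ (ε₀ / ℓ₀) * (ℓ / ε) := by
    rw [div_mul_div_comm, one_le_div (by positivity), mul_comm ℓ₀]
    gcongr
  have hLT : L ≤ K₁ * (ε₀ / ℓ₀) * T := by
    calc L ≤ K₁ * Λ * 1 := by rwa [mul_one]
      _ ≤ K₁ * Λ * ((ε₀ / ℓ₀) * (ℓ / ε)) := by gcongr
      _ = _ := by rw [hT]; ring
  have h1T : 1 ≤ K₃ * T := by
    calc (1 : ℝ) = 1 * 1 := by norm_num
      _ ≤ (Λ / Λ₀) * ((ε₀ / ℓ₀) * (ℓ / ε)) :=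
        mul_le_mul ((one_le_div hΛ₀0).mpr hΛ) hℓε zero_le_one (by positivity)
      _ = _ := by rw [hK₃, hT]; field_simp
  have hs : (⌈x⌉₊ : ℝ) ≤ K₁ * K₂ * T + K₃ * T :=
    (Nat.ceil_lt_add_one hx0.le).le.trans (add_le_add hxT h1T)
  refine ⟨⌈x⌉₊, ⌈2 * N * (⌈x⌉₊ + L) / α⌉₊, Nat.le_ceil _, Nat.le_ceil _, ?_⟩
  refine (Nat.ceil_lt_add_one (by positivity)).le.trans ?_
  have hPα : 1 ≤ P / α := (one_le_div hα).mpr (hα1.trans hP)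
  calc 2 * N * (⌈x⌉₊ + L) / α + 1
      ≤ 2 * (2 * Real.exp 2 * P) * ((K₁ * K₂ * T + K₃ * T) + K₁ * (ε₀ / ℓ₀) * T) / α +
        (K₃ * T) * (P / α) := by
        refine add_le_add ?_ ?_
        · gcongr
        · calc (1 : ℝ) = 1 * 1 := by norm_num
            _ ≤ _ := mul_le_mul h1T hPα zero_le_one (by positivity)
    _ = _ := by rw [hT]; field_simp; ring

end SampleComplexity

end DPLearn

theorem mainTheorem6 :
    (∀ d k : ℕ, 1 ≤ d →
      ((DPLearn.conjunctions d k).ncard : ℝ) ≤ Real.exp 2 * (d : ℝ) ^ k) ∧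
    (∀ ε₀ δ₀ β₀ : ℝ, 0 < ε₀ → 0 < δ₀ → δ₀ < 1 → 0 < β₀ → β₀ < 1 →
      ∃ K : ℝ, 0 < K ∧
        ∀ d k : ℕ, 1 ≤ d →
        ∀ ε δ α β : ℝ, 0 < ε → ε ≤ ε₀ → 0 < δ → δ ≤ δ₀ → 0 < α → α ≤ 1 → 0 < β → β ≤ β₀ →
          ∃ m : ℕ,
            (m : ℝ) ≤ K * ((d : ℝ) ^ k * Real.log ((d : ℝ) ^ k / β) * Real.log (1 / δ) / (α * ε)) ∧
            ∀ n : ℕ, m ≤ n →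
              ∃ A : DPLearn.Learner (Fin d → Bool) n,
                DPLearn.IsDP A ε δ ∧ DPLearn.IsPAC A (DPLearn.kDecisionLists d k) α β) := by
  refine ⟨fun d k hd => DPLearn.ncard_conjunctions_le_exp hd k, ?_⟩
  intro ε₀ δ₀ β₀ hε₀ hδ₀ hδ₀1 hβ₀ hβ₀1
  obtain ⟨K, hK, hsize⟩ := DPLearn.exists_sampleSize hε₀ hδ₀ hδ₀1 hβ₀ hβ₀1
  refine ⟨K, hK, fun d k hd ε δ α β hε hεε₀ hδ hδδ₀ hα hα1 hβ hββ₀ => ?_⟩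
  have hN := DPLearn.one_le_card_conjunctionRules d k
  have hP : (1 : ℝ) ≤ (d : ℝ) ^ k := one_le_pow₀ (by exact_mod_cast hd)
  have hNP : ((DPLearn.conjunctionRules d k).card : ℝ) ≤ 2 * Real.exp 2 * (d : ℝ) ^ k := by
    rw [DPLearn.card_conjunctionRules]
    push_cast
    linarith [DPLearn.ncard_conjunctions_le_exp hd k]
  obtain ⟨s, m, hs, hm, hmK⟩ := hsize _ _ ε δ α β hN hP hNP hε hεε₀ hδ hδδ₀ hα hα1 hβ hββ₀
  refine ⟨m, hmK, fun n hn => ?_⟩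
  have hδ1 : δ ≤ 1 := hδδ₀.trans hδ₀1.le
  have hβ1 : β ≤ 1 := hββ₀.trans hβ₀1.le
  have hlog : 0 ≤ Real.log (1 / δ) := Real.log_nonneg (by rwa [le_div_iff₀ hδ, one_mul])
  have hc : 0 < ε / (Real.log (1 / δ) + 2) := by positivity
  have hρ : 0 < (1 + ε / (Real.log (1 / δ) + 2))⁻¹ := by positivity
  have hmn : (m : ℝ) ≤ n := by exact_mod_cast hn
  exact ⟨_, DPLearn.isDP_greedyList hc.le hρ hδ hδ1 (div_mul_cancel₀ _ (by positivity)).le _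
      (DPLearn.conjunctionRules d k),
    DPLearn.isPAC_greedyList hρ (inv_le_one_of_one_le₀ (by linarith)) _
      (fun c hc => DPLearn.exists_rules_of_mem_kDecisionLists hc) hα.le hβ1
      (DPLearn.selection_failure_le hN hβ hc hs)
      (DPLearn.generalization_failure_le hN hβ hβ1 hα (hm.trans hmn))⟩
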